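/- For a rational number $m$ and an integer $n\ge 2$ let $f^{(n)}_m(X)=\sum_{i=0}^{n}\binom{n}{i}\,g(n-i)\,X^i\in\mathbb{Q}[X]$, where $g(i)=1,\,-m,\,-m-1,\,-1,\,m,\,m+1$ according as $i\equiv 0,1,2,3,4,5 \pmod 6$. For $t\in\mathbb{Z}$ let $f^{(n)}_t$ denote this polynomial with $m=t$ if $3\nmid n$, and with $m=t/3$ if $3\mid n$ (it then has integer coefficients); let $D_n(t)=t^2+t+1$ if $3\nmid n$, and $D_n(t)=t^2+3t+9$ if $3\mid n$. **Theorem.** Let $2\le n\le 12$, and let $n_0$ be given by the table $$\begin{array}{c|c|c|c|c|c|c|c|c|c|c|c} n & 2 & 3& 4& 5& 6& 7& 8& 9& 10& 11& 12\\\hline n_0 & 2^2& 1^3& (3\cdot4)^4& (3^3\cdot5)^5& (3^2\cdot6)^6& (3^4\cdot7)^7& (3^5\cdot8)^8& (3^4\cdot9)^9& (3^6\cdot10)^{10}& (3^9\cdot11)^{11}& (3^8\cdot12)^{12} \end{array}$$ Then, as $t$ runs through the integers for which $D_n(t)$ is square-free, an integral basis of the fields $\mathbb{Q}(\beta_t)$,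 where $\beta_t\in\mathbb{C}$ is a root of $f^{(n)}_t$, is repeating periodically modulo $n_0$. That is, for every residue class $r$ modulo $n_0$ there are polynomials $h^{(r)}_0,\dots,h^{(r)}_{n-1}\in\mathbb{Q}[X]$ with $\deg h^{(r)}_i=i$ such that, for every integer $t\equiv r\pmod{n_0}$ for which $D_n(t)$ is square-free and $f^{(n)}_t$ is irreducible over $\mathbb{Q}$, and for every root $\beta_t$ of $f^{(n)}_t$, the tuple $\bigl(h^{(r)}_0(\beta_t),\dots,h^{(r)}_{n-1}(\beta_t)\bigr)$ is an integral basis of $\mathbb{Q}(\beta_t)$, i.e. a $\mathbb{Z}$-basis of its ring of integers. -/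

import Mathlib

open Polynomial

/-- The coefficient function `g : ℕ → ℚ` with rational parameter `m`. -/
def simplestG (m : ℚ) (i : ℕ) : ℚ :=
  match i % 6 with
  | 0 => 1
  | 1 => -m
  | 2 => -m - 1
  | 3 => -1
  | 4 => m
  | _ => m + 1

/-- The generalized simplest polynomial `f_m^{(n)}(X) = ∑_{i=0}^n (n choose i) g(n-i) X^i`
with rational parameter `m`. -/
noncomputable def simplestPolyRat (n : ℕ) (m : ℚ) : ℚ[X] :=
  ∑ i ∈ Finset.range (n + 1), C ((n.choose i : ℚ) * simplestG m (n - i)) * X ^ i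

/-- The family `f_t^{(n)}` with integer parameter `t`: the rational parameter is `m = t` if
`3 ∤ n`, and `m = t / 3` if `3 ∣ n`. -/
noncomputable def simplestPoly (n : ℕ) (t : ℤ) : ℚ[X] :=
  simplestPolyRat n (if n % 3 = 0 then (t : ℚ) / 3 else (t : ℚ))

/-- The integer `t² + t + 1` if `3 ∤ n`, and `t² + 3t + 9` if `3 ∣ n`. -/
def paramForm (n : ℕ) (t : ℤ) : ℤ :=
  if n % 3 = 0 then t ^ 2 + 3 * t + 9 else t ^ 2 + t + 1

/-- The family `v` of elements of the field `K` is an integral basis of `K`: its members lie in the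
ring of integers of `K` and form a `ℤ`-basis of it. -/
def IsIntegralBasis {n : ℕ} {K : Type*} [Field K] (v : Fin n → K) : Prop :=
  ∃ b : Module.Basis (Fin n) ℤ (NumberField.RingOfIntegers K), ∀ i, (b i : K) = v i

/-- For a family `F t` of polynomials of degree `n` whose integer parameter `t` runs over `S`,
an integral basis of the fields `ℚ(β_t)`, where `β_t` is a root of `F t`, is repeating periodically
modulo `N`: for each residue class `r` there are polynomials `h i ∈ ℚ[X]` of degree `i`
(`0 ≤ i ≤ n - 1`) such that, whenever `t ∈ S` lies in the residue class and `F t` is irreducible,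
`(h 0 (β_t), …, h (n-1) (β_t))` is an integral basis of `ℚ(β_t)`. -/
def RepeatsPeriodicallyMod (n : ℕ) (F : ℤ → ℚ[X]) (S : Set ℤ) (N : ℕ) : Prop :=
  ∀ r : ℤ, ∃ h : Fin n → ℚ[X], (∀ i, (h i).degree = ((i : ℕ) : WithBot ℕ)) ∧
    ∀ t ∈ S, t ≡ r [ZMOD N] → Irreducible (F t) →
      ∀ β : ℂ, aeval β (F t) = 0 →
        IsIntegralBasis (K := IntermediateField.adjoin ℚ {β})
          (fun i => aeval (IntermediateField.AdjoinSimple.gen ℚ β) (h i))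

/-- The table of period lengths for `2 ≤ n ≤ 12` (the value elsewhere is irrelevant). -/
def periodLength (n : ℕ) : ℕ :=
  match n with
  | 2 => 2 ^ 2
  | 3 => 1 ^ 3
  | 4 => (3 * 4) ^ 4
  | 5 => (3 ^ 3 * 5) ^ 5
  | 6 => (3 ^ 2 * 6) ^ 6
  | 7 => (3 ^ 4 * 7) ^ 7
  | 8 => (3 ^ 5 * 8) ^ 8
  | 9 => (3 ^ 4 * 9) ^ 9
  | 10 => (3 ^ 6 * 10) ^ 10
  | 11 => (3 ^ 9 * 11) ^ 11
  | 12 => (3 ^ 8 * 12) ^ 12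
  | _ => 0

/-! Write β for a root of f = f_t, D for D_n(t), δ = f'(β), and d for the n-th root of the period.
Two facts carry the proof.

Denominators: if D is squarefree and f irreducible, then d times every integral element of ℚ(β) lies
in ℤ[β]. With z a primitive sixth root of unity, (2z - 1)f is a combination of (X + z)^n and (X + 1
- z)^n (`map_simplestPolyRat`). Hence δ² = n²(m² + m + 1)(β² + β + 1)^(n-2), and (β² + β + 1)^n
divides 3^n D among algebraic integers; for n = 3 it even divides D. So (D d/δ)^(2n) is D times an
algebraic integer (`exists_pow_div_derivative_eq`). For integral x and v in ℤ[β], all conjugates of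
D d x v/δ are then nilpotent modulo D, and so is their sum. Since D is squarefree, the trace of d x
v/δ is an integer. Thus d x/δ lies in the trace dual δ⁻¹ℤ[β], and d x lies in ℤ[β]
(`smul_mem_adjoin_of_pow_eq`).

Transfer: f_t is affine in t, so t ≡ t' mod d^n gives f_t ≡ f_t' mod d^n. If P has denominator d and
P(β_t) is integral with minimal polynomial ψ of degree k ≤ n, then d^k ψ(P) is an integral
polynomial divisible by f_t. At β_t' its value is therefore d^n times an element of ℤ[β_t'], so
ψ(P(β_t')) is integral, and so is P(β_t') (`isIntegral_aeval_of_congr`).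

Consequently the lattice of polynomials P of degree below n with P(β_t) integral depends only on the
residue class of t. A triangular basis of this lattice (`exists_triangular_span`) serves the whole
class. -/

theorem IsIntegral.of_mem_adjoin_singleton {R A : Type*} [CommRing R] [CommRing A] [Algebra R A]
    {x y : A} (hx : IsIntegral R x) (hy : y ∈ Algebra.adjoin R {x}) : IsIntegral R y := by
  have hle : Algebra.adjoin R {x} ≤ integralClosure R A :=
    Algebra.adjoin_le (Set.singleton_subset_iff.2 hx)
  exact hle hy

/-! ### Triangular bases of lattices of polynomials -/

/-- A subgroup of `ℚ[X]` with leading coefficients in `(1 / d) ℤ` contains, in each degree,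
a polynomial whose leading coefficient divides all the others in that degree. -/
theorem exists_minimal_leadingCoeff (Λ : AddSubgroup ℚ[X]) (n i : ℕ) (hi : i < n) (d : ℤ)
    (hd : d ≠ 0) (hX : (X ^ i : ℚ[X]) ∈ Λ)
    (hint : ∀ P ∈ Λ, P.degree < n → ∀ j, ∃ a : ℤ, d * P.coeff j = a) :
    ∃ h ∈ Λ, h.degree = (i : WithBot ℕ) ∧
      ∀ P ∈ Λ, P.degree < ((i + 1 : ℕ) : WithBot ℕ) → ∃ c : ℤ, P.coeff i = c * h.coeff i := by
  let H : AddSubgroup ℤ :=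
    { carrier := {a | ∃ P ∈ Λ, P.degree < ((i + 1 : ℕ) : WithBot ℕ) ∧ d * P.coeff i = a}
      zero_mem' := ⟨0, Λ.zero_mem, by simp, by simp⟩
      add_mem' := by
        rintro a b ⟨P, hP, hPd, hPa⟩ ⟨Q, hQ, hQd, hQb⟩
        refine ⟨P + Q, Λ.add_mem hP hQ, lt_of_le_of_lt (degree_add_le _ _) (max_lt hPd hQd), ?_⟩
        push_cast
        rw [coeff_add, mul_add, hPa, hQb]
      neg_mem' := by
        rintro a ⟨P, hP, hPd, hPa⟩
        refine ⟨-P, Λ.neg_mem hP, by rwa [degree_neg], ?_⟩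
        push_cast
        rw [coeff_neg, mul_neg, hPa] }
  obtain ⟨g, hg⟩ := Int.subgroup_cyclic H
  have hdq : (d : ℚ) ≠ 0 := by exact_mod_cast hd
  have hle : ((i + 1 : ℕ) : WithBot ℕ) ≤ n := by exact_mod_cast hi
  -- The monic polynomial X^i makes H nonzero; a polynomial realizing the generator g of H is then
  -- the required h.
  have hdH : d ∈ H := ⟨X ^ i, hX, by
    rw [degree_X_pow]; exact_mod_cast Nat.lt_succ_self i, by simp⟩
  have hgH : g ∈ H := by rw [hg]; exact AddSubgroup.mem_closure_singleton_self g
  have hmem : ∀ a ∈ H, ∃ c : ℤ, a = c * g := by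
    intro a ha
    rw [hg, AddSubgroup.mem_closure_singleton] at ha
    obtain ⟨c, hc⟩ := ha
    exact ⟨c, by simpa using hc.symm⟩
  have hg0 : g ≠ 0 := by
    rintro rfl
    obtain ⟨c, hc⟩ := hmem d hdH
    exact hd (by simpa using hc)
  obtain ⟨h, hh, hhd, hhg⟩ := hgH
  have hlt : ∀ P : ℚ[X], P.degree < ((i + 1 : ℕ) : WithBot ℕ) → P.degree ≤ (i : WithBot ℕ) := by
    intro P hP
    rw [degree_lt_iff_coeff_zero] at hP
    rw [degree_le_iff_coeff_zero]
    intro m hm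
    exact hP m (by exact_mod_cast hm)
  refine ⟨h, hh, ?_, ?_⟩
  · refine degree_eq_of_le_of_coeff_ne_zero (hlt h hhd) ?_
    intro h0
    rw [h0, mul_zero] at hhg
    exact hg0 (by exact_mod_cast hhg.symm)
  · intro P hP hPd
    obtain ⟨a, ha⟩ := hint P hP (lt_of_lt_of_le hPd hle) i
    obtain ⟨c, hc⟩ := hmem a ⟨P, hP, hPd, ha⟩
    refine ⟨c, mul_left_cancel₀ hdq ?_⟩
    rw [ha, hc]
    push_cast
    rw [← hhg]
    ring

/-- A subgroup of `ℚ[X]` that contains the powers of `X` of degree less than `n`, and whose members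
of degree less than `n` have a common denominator, has a triangular basis in these degrees. -/
theorem exists_triangular_span (Λ : AddSubgroup ℚ[X]) (n : ℕ) (d : ℤ) (hd : d ≠ 0)
    (hX : ∀ i < n, (X ^ i : ℚ[X]) ∈ Λ)
    (hint : ∀ P ∈ Λ, P.degree < n → ∀ j, ∃ a : ℤ, d * P.coeff j = a) :
    ∃ h : Fin n → ℚ[X], (∀ i, (h i).degree = ((i : ℕ) : WithBot ℕ)) ∧ (∀ i, h i ∈ Λ) ∧
      ∀ P ∈ Λ, P.degree < n → P ∈ Submodule.span ℤ (Set.range h) := by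
  have key := fun i : Fin n =>
    exists_minimal_leadingCoeff Λ n i i.2 d hd (hX i i.2) hint
  choose h hh hdeg hdvd using key
  refine ⟨h, hdeg, hh, ?_⟩
  have main : ∀ m ≤ n, ∀ P ∈ Λ, P.degree < (m : WithBot ℕ) →
      P ∈ Submodule.span ℤ (Set.range h) := by
    intro m
    induction m with
    | zero =>
      intro _ P _ hP
      have : P = 0 := by
        rw [degree_lt_iff_coeff_zero] at hP
        ext j
        simpa using hP j (Nat.zero_le j)
      rw [this]
      exact Submodule.zero_mem _
    | succ m ih =>
      intro hm P hP hPd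
      obtain ⟨c, hc⟩ := hdvd ⟨m, hm⟩ P hP hPd
      have hsub : P - c • h ⟨m, hm⟩ ∈ Λ := Λ.sub_mem hP (Λ.zsmul_mem (hh _) c)
      have hlt : (P - c • h ⟨m, hm⟩).degree < (m : WithBot ℕ) := by
        rw [degree_lt_iff_coeff_zero]
        intro j hj
        rcases hj.eq_or_lt with rfl | hj
        · rw [coeff_sub, coeff_smul, hc, zsmul_eq_mul, sub_self]
        · have h1 := (degree_lt_iff_coeff_zero _ _).1 hPd j hj
          have h2 : (h ⟨m, hm⟩).coeff j = 0 := coeff_eq_zero_of_degree_lt (by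
            rw [hdeg]; exact_mod_cast hj)
          rw [coeff_sub, coeff_smul, h1, h2, smul_zero, sub_zero]
      have := ih (by omega) _ hsub hlt
      have h3 : P = (P - c • h ⟨m, hm⟩) + c • h ⟨m, hm⟩ := by ring
      rw [h3]
      exact Submodule.add_mem _ this (Submodule.smul_mem _ _ (Submodule.subset_span ⟨_, rfl⟩))
  exact main n le_rfl

/-! ### Transfer of integrality between congruent polynomials -/

/-- An element of `ℚ(β)` that is integral over `ℤ` is a root of a monic integral polynomial of
degree at most the degree of `β`. -/
theorem natDegree_minpoly_int_le {β : ℂ} {n : ℕ} {f : ℚ[X]} (hf : f.natDegree = n) (hf0 : f ≠ 0)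
    (hβ : aeval β f = 0) (P : ℚ[X]) (hP : IsIntegral ℤ (aeval β P)) :
    (minpoly ℤ (aeval β P)).natDegree ≤ n := by
  have hβi : IsIntegral ℚ β := isAlgebraic_iff_isIntegral.1 ⟨f, hf0, hβ⟩
  have h1 : (minpoly ℤ (aeval β P)).natDegree = (minpoly ℚ (aeval β P)).natDegree := by
    rw [minpoly.isIntegrallyClosed_eq_field_fractions' ℚ hP,
      natDegree_map_eq_of_injective (algebraMap ℤ ℚ).injective_int]
  have : FiniteDimensional ℚ (IntermediateField.adjoin ℚ {β}) :=
    IntermediateField.adjoin.finiteDimensional hβi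
  have h2 : aeval β P = algebraMap (IntermediateField.adjoin ℚ {β}) ℂ
      (aeval (IntermediateField.AdjoinSimple.gen ℚ β) P) := by
    rw [← aeval_algebraMap_apply, IntermediateField.AdjoinSimple.algebraMap_gen]
  rw [h1, h2, minpoly.algebraMap_eq (algebraMap (IntermediateField.adjoin ℚ {β}) ℂ).injective]
  refine (minpoly.natDegree_le _).trans ?_
  rw [IntermediateField.adjoin.finrank hβi, ← hf]
  exact natDegree_le_of_dvd (minpoly.dvd ℚ β hβ) hf0

/-- If two monic integral polynomials of degree `n` are congruent modulo `d ^ n` and the first is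
irreducible, then integrality of `P(β)` for a root `β` of the first carries over to the roots of
the second, for polynomials `P` with denominator dividing `d`. -/
theorem isIntegral_aeval_of_congr {F F' : ℤ[X]} {n : ℕ} {d : ℤ} (hF : F.Monic) (hF' : F'.Monic)
    (hn : F.natDegree = n) (hirr : Irreducible (F.map (Int.castRingHom ℚ)))
    (hFF' : C (d ^ n) ∣ F - F') {β β' : ℂ} (hβ : aeval β F = 0)
    (hβ' : aeval β' F' = 0) (hd : d ≠ 0) {P : ℚ[X]} {a : ℤ[X]}
    (ha : C (d : ℚ) * P = a.map (Int.castRingHom ℚ)) (hP : IsIntegral ℤ (aeval β P)) :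
    IsIntegral ℤ (aeval β' P) := by
  have hmapβ : ∀ (x : ℂ) (Q : ℤ[X]), aeval x (Q.map (Int.castRingHom ℚ)) = aeval x Q := by
    intro x Q
    exact aeval_map_algebraMap ℚ x Q
  have hda : ∀ x : ℂ, aeval x a = d * aeval x P := by
    intro x
    rw [← hmapβ, ← ha]
    simp
  set ψ := minpoly ℤ (aeval β P) with hψ
  have hψm : ψ.Monic := minpoly.monic hP
  have hψd : ψ.natDegree ≤ n := by
    refine natDegree_minpoly_int_le (f := F.map (Int.castRingHom ℚ)) ?_ (hF.map _).ne_zero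
      (by rw [hmapβ, hβ]) P hP
    rw [hF.natDegree_map, hn]
  have hψ0 : ψ.natDegree ≠ 0 := (minpoly.natDegree_pos hP).ne'
  -- Since P = a/d, scaling the roots of ψ by d and substituting a gives d^(deg ψ) ψ(P), with
  -- integral coefficients.
  have hscale : ∀ x : ℂ, aeval x ((ψ.scaleRoots d).comp a) = d ^ ψ.natDegree *
      aeval (aeval x P) ψ := by
    intro x
    rw [aeval_comp, hda]
    generalize aeval x P = y
    have := scaleRoots_eval₂_mul (p := ψ) (algebraMap ℤ ℂ) y d
    simpa [aeval_def] using this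
  have hβint : IsIntegral ℤ β := ⟨F, hF, hβ⟩
  have hβ'int : IsIntegral ℤ β' := ⟨F', hF', hβ'⟩
  have hmin : minpoly ℤ β = F := by
    apply map_injective (Int.castRingHom ℚ) (Int.castRingHom ℚ).injective_int
    have h1 := minpoly.isIntegrallyClosed_eq_field_fractions' ℚ hβint
    have h2 := minpoly.eq_of_irreducible_of_monic hirr (by rw [hmapβ, hβ]) (hF.map _)
    rw [h2]
    exact h1.symm
  -- As F is the minimal polynomial over ℤ, divisibility holds in ℤ[X] and the quotient q is
  -- integral.
  have hdvd : F ∣ (ψ.scaleRoots d).comp a := by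
    rw [← hmin]
    refine minpoly.isIntegrallyClosed_dvd hβint ?_
    rw [hscale, minpoly.aeval, mul_zero]
  obtain ⟨q, hq⟩ := hdvd
  obtain ⟨G, hG⟩ := hFF'
  have hdC : (d : ℂ) ≠ 0 := by exact_mod_cast hd
  -- Modulo F' only the term d^n G q survives; deg ψ ≤ n allows cancelling d^(deg ψ).
  have hval : aeval (aeval β' P) ψ = aeval β' (C (d ^ (n - ψ.natDegree)) * G * q) := by
    have h1 := hscale β'
    have hFeq : F = F' + C (d ^ n) * G := by rw [← hG]; ring
    rw [hq, hFeq] at h1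
    simp only [map_mul, map_add, hβ', zero_add, aeval_C] at h1 ⊢
    have hpow : (d : ℂ) ^ n = d ^ ψ.natDegree * d ^ (n - ψ.natDegree) := by
      rw [← pow_add, Nat.add_sub_cancel' hψd]
    simp only [eq_intCast, Int.cast_pow] at h1 ⊢
    rw [hpow] at h1
    refine mul_left_cancel₀ (pow_ne_zero ψ.natDegree hdC) ?_
    rw [← h1]
    ring
  refine IsIntegral.of_aeval_monic hψm hψ0 ?_
  rw [hval]
  exact hβ'int.of_mem_adjoin_singleton (aeval_mem_adjoin_singleton ℤ β')

/-! ### Denominators of integral elements via the trace dual -/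

/-- The sum of integral elements with a common power divisible by `D` is nilpotent modulo `D`. -/
theorem exists_pow_sum_eq_mul {ι : Type*} (s : Finset ι) (x : ι → ℂ) (D : ℤ) (N : ℕ)
    (hx : ∀ i ∈ s, IsIntegral ℤ (x i))
    (hN : ∀ i ∈ s, ∃ y : ℂ, IsIntegral ℤ y ∧ x i ^ N = D * y) :
    ∃ (k : ℕ) (y : ℂ), IsIntegral ℤ y ∧ (∑ i ∈ s, x i) ^ k = D * y := by
  classical
  let A := integralClosure ℤ ℂ
  let I : Ideal A := Ideal.span {(D : A)}
  let a : ι → A := fun i => if h : IsIntegral ℤ (x i) then ⟨x i, h⟩ else 0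
  have ha : ∀ i ∈ s, (a i : ℂ) = x i := by
    intro i hi
    simp only [a, dif_pos (hx i hi)]
  -- In the commutative ring of algebraic integers modulo D each summand is nilpotent, hence so is
  -- the sum.
  have hnil : IsNilpotent (∑ i ∈ s, Ideal.Quotient.mk I (a i)) := by
    refine isNilpotent_sum fun i hi => ⟨N, ?_⟩
    obtain ⟨y, hy, hxy⟩ := hN i hi
    rw [← map_pow, Ideal.Quotient.eq_zero_iff_mem, Ideal.mem_span_singleton]
    refine ⟨⟨y, hy⟩, Subtype.ext ?_⟩
    push_cast
    rw [ha i hi, hxy]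
  obtain ⟨k, hk⟩ := hnil
  rw [← map_sum, ← map_pow, Ideal.Quotient.eq_zero_iff_mem, Ideal.mem_span_singleton] at hk
  obtain ⟨y, hy⟩ := hk
  refine ⟨k, y, y.2, ?_⟩
  have := congrArg (Subtype.val) hy
  push_cast at this
  rw [Finset.sum_congr rfl ha] at this
  exact this

/-- If `D` is squarefree and a power of `D z` is `D` times an integral element, then the trace of
`z` is an integer. -/
theorem exists_int_eq_trace {K : Type*} [Field K] [Algebra ℚ K] [FiniteDimensional ℚ K]
    {D : ℤ} (hD : Squarefree D) {z y : K} {N : ℕ} (hN : N ≠ 0) (hy : IsIntegral ℤ y)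
    (hz : ((D : K) * z) ^ N = D * y) : ∃ a : ℤ, Algebra.trace ℚ K z = a := by
  have hzi : IsIntegral ℤ ((D : K) * z) := by
    refine IsIntegral.of_pow (Nat.pos_of_ne_zero hN) ?_
    rw [hz]
    exact (isIntegral_algebraMap (x := D)).mul hy
  obtain ⟨b, hb⟩ := IsIntegrallyClosed.isIntegral_iff.1
    (Algebra.isIntegral_trace (L := ℚ) hzi)
  have hsum := trace_eq_sum_embeddings (K := ℚ) ℂ (x := (D : K) * z)
  have hint : ∀ (σ : K →ₐ[ℚ] ℂ) (x : K), IsIntegral ℤ x → IsIntegral ℤ (σ x) := by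
    intro σ x hx
    exact hx.map (σ.restrictScalars ℤ)
  obtain ⟨k, u, hu, hk⟩ := exists_pow_sum_eq_mul Finset.univ
    (fun σ : K →ₐ[ℚ] ℂ => σ ((D : K) * z)) D N (fun σ _ => hint σ _ hzi)
    (fun σ _ => ⟨σ y, hint σ y hy, by rw [← map_pow, hz, map_mul, map_intCast]⟩)
  rw [← hsum, ← hb] at hk
  have hD0 : (D : ℂ) ≠ 0 := by exact_mod_cast hD.ne_zero
  have hu' : u = algebraMap ℚ ℂ ((b : ℚ) ^ k / D) := by
    have : u = (b : ℂ) ^ k / D := by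
      rw [eq_div_iff hD0, mul_comm, ← hk]
      simp
    rw [this]
    simp
  rw [hu', isIntegral_algebraMap_iff (algebraMap ℚ ℂ).injective] at hu
  obtain ⟨c, hc⟩ := IsIntegrallyClosed.isIntegral_iff.1 hu
  have hDq : (D : ℚ) ≠ 0 := by exact_mod_cast hD.ne_zero
  -- The exponent is raised to k + 1 because squarefreeness yields D ∣ b only from a nonzero
  -- exponent, and k may be 0.
  have hdvd : D ∣ b ^ (k + 1) := by
    refine Dvd.dvd.trans ⟨c, ?_⟩ (pow_dvd_pow b (Nat.le_succ k))
    rw [eq_intCast, eq_div_iff hDq] at hc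
    have hc' : c * D = b ^ k := by exact_mod_cast hc
    rw [← hc', mul_comm]
  rw [hD.dvd_pow_iff_dvd (Nat.succ_ne_zero k)] at hdvd
  obtain ⟨a, rfl⟩ := hdvd
  refine ⟨a, mul_left_cancel₀ hDq ?_⟩
  have h1 : Algebra.trace ℚ K ((D : K) * z) = D * Algebra.trace ℚ K z := by
    have : (D : K) * z = (D : ℚ) • z := by rw [Algebra.smul_def]; simp
    rw [this, map_smul, smul_eq_mul]
  rw [← h1, ← hb]
  simp

/-- A criterion for `d` to annihilate `𝓞 K / ℤ[θ]`. -/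
theorem smul_mem_adjoin_of_pow_eq {K : Type*} [Field K] [Algebra ℚ K] [FiniteDimensional ℚ K]
    {θ : K} (hθ : Algebra.adjoin ℚ {θ} = ⊤) (hθi : IsIntegral ℤ θ) {D d : ℤ} (hD : Squarefree D)
    {y : K} {N : ℕ} (hN : N ≠ 0) (hy : IsIntegral ℤ y)
    (h : ((D : K) * d / aeval θ (derivative (minpoly ℚ θ))) ^ N = D * y)
    {x : K} (hx : IsIntegral ℤ x) : (d : K) * x ∈ Algebra.adjoin ℤ {θ} := by
  set δ := aeval θ (derivative (minpoly ℚ θ)) with hδ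
  have hsep : IsSeparable ℚ θ := Algebra.IsSeparable.isSeparable ℚ θ
  have hδ0 : δ ≠ 0 := Separable.aeval_derivative_ne_zero hsep (minpoly.aeval ℚ θ)
  -- Euler's formula: the trace dual of ℤ[θ] is δ⁻¹ℤ[θ].
  have hdual := traceForm_dualSubmodule_adjoin ℤ ℚ hθ hθi
  rw [← hδ] at hdual
  have hmem : δ⁻¹ * (d * x) ∈
      (Algebra.traceForm ℚ K).dualSubmodule (Subalgebra.toSubmodule (Algebra.adjoin ℤ {θ})) := by
    rw [LinearMap.BilinForm.mem_dualSubmodule]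
    intro v hv
    have hvi : IsIntegral ℤ v := hθi.of_mem_adjoin_singleton hv
    obtain ⟨a, ha⟩ := exists_int_eq_trace hD (z := δ⁻¹ * (d * x) * v) hN
      (hy.mul ((hx.mul hvi).pow N)) (by
        rw [show (D : K) * (δ⁻¹ * (d * x) * v) = (D : K) * d / δ * (x * v) by
          rw [div_eq_mul_inv]; ring, mul_pow, h]
        ring)
    rw [Algebra.traceForm_apply, ha, Submodule.mem_one]
    exact ⟨a, by simp⟩
  rw [hdual, Submodule.mem_smul_pointwise_iff_exists] at hmem
  obtain ⟨u, hu, hux⟩ := hmem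
  rw [smul_eq_mul] at hux
  have := mul_left_cancel₀ (inv_ne_zero hδ0) hux
  rw [← this]
  exact hu

/-! ### Integrality of the coefficients of the family -/

theorem three_dvd_choose {n i : ℕ} (hn : n % 3 = 0) (hi : i % 3 ≠ 0) : 3 ∣ n.choose i := by
  obtain ⟨i, rfl⟩ : ∃ j, i = j + 1 := ⟨i - 1, by omega⟩
  rcases n with _ | n
  · simp
  · have h := Nat.add_one_mul_choose_eq n i
    have h3 : 3 ∣ (n + 1).choose (i + 1) * (i + 1) := by
      rw [← h]
      exact (Nat.dvd_of_mod_eq_zero hn).mul_right _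
    exact (Nat.Prime.dvd_mul Nat.prime_three).1 h3 |>.resolve_right (by omega)

/-- The vanishing of b for 3 ∣ i matters when 3 ∣ n and m = t/3: the parameter then occurs only next
to binomial coefficients divisible by 3. -/
theorem exists_simplestG_eq (i : ℕ) :
    ∃ a b : ℤ, (i % 3 = 0 → b = 0) ∧ ∀ m : ℚ, simplestG m i = a + m * b := by
  have h : i % 6 < 6 := Nat.mod_lt _ (by norm_num)
  unfold simplestG
  rcases hr : i % 6 with _ | _ | _ | _ | _ | _ | k
  · exact ⟨1, 0, fun _ => rfl, fun m => by simp⟩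
  · exact ⟨0, -1, fun _ => by omega, fun m => by simp⟩
  · exact ⟨-1, -1, fun _ => by omega, fun m => by push_cast; ring⟩
  · exact ⟨-1, 0, fun _ => rfl, fun m => by simp⟩
  · exact ⟨0, 1, fun _ => by omega, fun m => by simp⟩
  · exact ⟨1, 1, fun _ => by omega, fun m => by push_cast; ring⟩
  · omega

/-- The family `simplestPoly n` has integral coefficients, affine in the parameter. -/
theorem exists_int_simplestPoly (n : ℕ) :
    ∃ F₀ F₁ : ℤ[X], ∀ t : ℤ, (F₀ + C t * F₁).map (Int.castRingHom ℚ) = simplestPoly n t := by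
  have key : ∀ i : ℕ, ∃ p q : ℤ, i ≤ n → ∀ t : ℤ, (n.choose i : ℚ) *
      simplestG (if n % 3 = 0 then (t : ℚ) / 3 else (t : ℚ)) (n - i) = p + t * q := by
    intro i
    obtain ⟨a, b, hb, hg⟩ := exists_simplestG_eq (n - i)
    by_cases hn : n % 3 = 0
    · by_cases hi : i % 3 = 0
      · refine ⟨n.choose i * a, 0, fun hin t => ?_⟩
        rw [hg, hb (by omega)]
        push_cast
        ring
      · obtain ⟨c, hc⟩ := three_dvd_choose hn hi
        refine ⟨n.choose i * a, c * b, fun hin t => ?_⟩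
        rw [hg, if_pos hn, hc]
        push_cast
        ring
    · refine ⟨n.choose i * a, n.choose i * b, fun hin t => ?_⟩
      rw [hg, if_neg hn]
      push_cast
      ring
  choose p q hpq using key
  refine ⟨∑ i ∈ Finset.range (n + 1), C (p i) * X ^ i,
    ∑ i ∈ Finset.range (n + 1), C (q i) * X ^ i, fun t => ?_⟩
  rw [simplestPoly, simplestPolyRat, Finset.mul_sum, ← Finset.sum_add_distrib, Polynomial.map_sum]
  refine Finset.sum_congr rfl fun i hi => ?_
  rw [hpq i (Nat.lt_succ_iff.1 (Finset.mem_range.1 hi)) t]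
  simp
  ring

theorem simplestPolyRat_eq_X_pow_add (n : ℕ) (m : ℚ) :
    ∃ p : ℚ[X], p.degree < n ∧ simplestPolyRat n m = X ^ n + p := by
  refine ⟨∑ i ∈ Finset.range n, C ((n.choose i : ℚ) * simplestG m (n - i)) * X ^ i, ?_, ?_⟩
  · rw [← mem_degreeLT]
    refine Submodule.sum_mem _ fun i hi => ?_
    rw [mem_degreeLT]
    exact (degree_C_mul_X_pow_le _ _).trans_lt (by exact_mod_cast Finset.mem_range.1 hi)
  · rw [simplestPolyRat, Finset.sum_range_succ, add_comm]
    simp [simplestG]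

theorem simplestPoly_monic (n : ℕ) (t : ℤ) : (simplestPoly n t).Monic := by
  obtain ⟨p, hp, h⟩ := simplestPolyRat_eq_X_pow_add n (if n % 3 = 0 then (t : ℚ) / 3 else (t : ℚ))
  rw [simplestPoly, h]
  exact monic_X_pow_add hp

theorem simplestPoly_natDegree (n : ℕ) (t : ℤ) : (simplestPoly n t).natDegree = n := by
  obtain ⟨p, hp, h⟩ := simplestPolyRat_eq_X_pow_add n (if n % 3 = 0 then (t : ℚ) / 3 else (t : ℚ))
  rw [simplestPoly, h, natDegree_add_eq_left_of_degree_lt (by rwa [degree_X_pow]),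
    natDegree_X_pow]

/-! ### Expression through two n-th powers -/

/-- The sequence g satisfies g(i+2) = g(i+1) - g(i), whose characteristic roots are the primitive
sixth roots of unity z and 1 - z. The coefficients come from g(0) = 1 and g(1) = -m. -/
theorem simplestG_mul {z : ℂ} (hz : z ^ 2 - z + 1 = 0) (m : ℚ) (i : ℕ) :
    (2 * z - 1) * (simplestG m i : ℂ) = -(m + (1 - z)) * z ^ i + (m + z) * (1 - z) ^ i := by
  have hpow : ∀ x : ℂ, x ^ 2 - x + 1 = 0 → x ^ 3 = -1 ∧ x ^ 4 = -x ∧ x ^ 5 = 1 - x ∧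
      x ^ i = x ^ (i % 6) := by
    intro x hx
    have h6 : x ^ 6 = 1 := by linear_combination (x ^ 4 + x ^ 3 - x - 1) * hx
    refine ⟨by linear_combination (x + 1) * hx, by linear_combination (x ^ 2 + x) * hx,
      by linear_combination (x ^ 3 + x ^ 2 - 1) * hx, ?_⟩
    conv_lhs => rw [← Nat.div_add_mod i 6, pow_add, pow_mul, h6, one_pow, one_mul]
  have hz' : (1 - z) ^ 2 - (1 - z) + 1 = 0 := by linear_combination hz
  obtain ⟨h3, h4, h5, hi⟩ := hpow z hz
  obtain ⟨h3', h4', h5', hi'⟩ := hpow (1 - z) hz'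
  have h2 : z ^ 2 = z - 1 := by linear_combination hz
  have h2' : (1 - z) ^ 2 = -z := by linear_combination hz
  have h : i % 6 < 6 := Nat.mod_lt _ (by norm_num)
  rw [hi, hi', simplestG]
  rcases hr : i % 6 with _ | _ | _ | _ | _ | _ | k
  · push_cast; ring
  · push_cast; ring
  · rw [h2, h2']; push_cast; ring
  · rw [h3, h3']; push_cast; ring
  · rw [h4, h4']; push_cast; ring
  · rw [h5, h5']; push_cast; ring
  · omega

/-- Over a field with a primitive sixth root of unity `z`, the polynomial is a combination of the
two `n`-th powers `(X + z) ^ n` and `(X + z⁻¹) ^ n`. -/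
theorem map_simplestPolyRat {z : ℂ} (hz : z ^ 2 - z + 1 = 0) (n : ℕ) (m : ℚ) :
    C (2 * z - 1) * (simplestPolyRat n m).map (algebraMap ℚ ℂ) =
      C (-((m : ℂ) + (1 - z))) * (X + C z) ^ n + C ((m : ℂ) + z) * (X + C (1 - z)) ^ n := by
  rw [simplestPolyRat, Polynomial.map_sum, add_pow, add_pow, Finset.mul_sum, Finset.mul_sum,
    Finset.mul_sum, ← Finset.sum_add_distrib]
  refine Finset.sum_congr rfl fun i _ => ?_
  have h := congrArg (C : ℂ → ℂ[X]) (simplestG_mul hz m (n - i))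
  simp only [map_mul, map_add, map_neg, map_pow] at h
  simp only [Polynomial.map_mul, map_C, Polynomial.map_pow, map_X, map_mul, Polynomial.map_natCast, map_natCast,
    eq_ratCast, map_neg, map_add]
  linear_combination (X ^ i * (n.choose i : ℂ[X])) * h

/-- Although g need not be integral, each a g^i with i ≤ n is, because its n-th power is a^(n-i)
b^i. Expanding (1 - g)^n then gives the claim. -/
theorem IsIntegral.mul_one_sub_pow {a b g : ℂ} (ha : IsIntegral ℤ a) (hb : IsIntegral ℤ b) {n : ℕ}
    (hn : 0 < n) (h : a * g ^ n = b) : IsIntegral ℤ (a * (1 - g) ^ n) := by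
  rw [sub_eq_neg_add, add_pow, Finset.mul_sum]
  refine IsIntegral.sum _ fun i hi => ?_
  have hin : i ≤ n := Nat.lt_succ_iff.1 (Finset.mem_range.1 hi)
  have h1 : IsIntegral ℤ (a * g ^ i) := by
    refine IsIntegral.of_pow hn ?_
    have : (a * g ^ i) ^ n = a ^ (n - i) * b ^ i := by
      rw [← h, mul_pow, mul_pow, ← mul_assoc, ← pow_add, Nat.sub_add_cancel hin, ← pow_mul,
        ← pow_mul, mul_comm i n]
    rw [this]
    exact (ha.pow _).mul (hb.pow _)
  have h2 : a * ((-g) ^ i * 1 ^ (n - i) * (n.choose i : ℂ)) =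
      a * g ^ i * (((-1 : ℤ) ^ i * (n.choose i : ℤ) : ℤ) : ℂ) := by
    rw [neg_pow]
    push_cast
    ring
  rw [h2]
  exact h1.mul (isIntegral_algebraMap (x := ((-1 : ℤ) ^ i * (n.choose i : ℤ))))

/-! ### The derivative and β² + β + 1 at a root -/

section Root

variable {n : ℕ} {m : ℚ} {β : ℂ}

theorem sq_add_add_one_ne_zero (m : ℚ) : ((m : ℂ) ^ 2 + m + 1) ≠ 0 := by
  have : m ^ 2 + m + 1 ≠ 0 := by nlinarith [sq_nonneg (2 * m + 1)]
  exact_mod_cast this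

theorem exists_sixth_root : ∃ z : ℂ, z ^ 2 - z + 1 = 0 := by
  obtain ⟨s, hs⟩ := IsAlgClosed.exists_pow_nat_eq (-3 : ℂ) (n := 2) (by norm_num)
  exact ⟨(1 + s) / 2, by linear_combination hs / 4⟩

theorem root_relation (hβ : aeval β (simplestPolyRat n m) = 0) {z : ℂ}
    (hz : z ^ 2 - z + 1 = 0) :
    ((m : ℂ) + (1 - z)) * (β + z) ^ n = (m + z) * (β + (1 - z)) ^ n := by
  have h := congrArg (eval β) (map_simplestPolyRat hz n m)
  rw [eval_mul, eval_map_algebraMap, hβ] at h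
  simp only [mul_zero, eval_add, eval_mul, eval_C, eval_pow, eval_X] at h
  linear_combination h

theorem two_mul_sub_one_ne_zero {z : ℂ} (hz : z ^ 2 - z + 1 = 0) : 2 * z - 1 ≠ 0 := by
  intro h
  have : (3 : ℂ) = 0 := by linear_combination 4 * hz - (2 * z - 1) * h
  norm_num at this

theorem root_add_ne_zero (hβ : aeval β (simplestPolyRat n m) = 0) (hn : 0 < n)
    {z : ℂ} (hz : z ^ 2 - z + 1 = 0) : β + z ≠ 0 := by
  intro h
  have hr := root_relation hβ hz
  rw [h, zero_pow hn.ne', mul_zero] at hr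
  have hs : β + (1 - z) ≠ 0 := by
    intro h'
    exact two_mul_sub_one_ne_zero hz (by linear_combination h - h')
  have h1 : (m : ℂ) + z = 0 := (mul_eq_zero.1 hr.symm).resolve_right (pow_ne_zero _ hs)
  exact sq_add_add_one_ne_zero m (by linear_combination (m + 1 - z) * h1 + hz)

theorem root_sq_add_add_one_ne_zero (hβ : aeval β (simplestPolyRat n m) = 0) (hn : 0 < n) :
    β ^ 2 + β + 1 ≠ 0 := by
  obtain ⟨z, hz⟩ := exists_sixth_root
  have h1 := root_add_ne_zero hβ hn hz
  have h2 := root_add_ne_zero hβ hn (z := 1 - z) (by linear_combination hz)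
  have h3 : β ^ 2 + β + 1 = (β + z) * (β + (1 - z)) := by linear_combination hz
  rw [h3]
  exact mul_ne_zero h1 h2

/-- Differentiating the two-power expression, multiplying by β + z and applying `root_relation`
leaves the common factor (β + z) - (β + 1 - z) = 2z - 1, which cancels. -/
theorem derivative_mul_root_add (hβ : aeval β (simplestPolyRat n m) = 0) (hn : 0 < n)
    {z : ℂ} (hz : z ^ 2 - z + 1 = 0) :
    aeval β (derivative (simplestPolyRat n m)) * (β + z) =
      n * (m + z) * (β + (1 - z)) ^ (n - 1) := by
  have h := congrArg (fun p => eval β (derivative p)) (map_simplestPolyRat hz n m)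
  simp only [derivative_mul, derivative_C, zero_mul, zero_add, derivative_map, derivative_add,
    derivative_X_add_C_pow, eval_mul, eval_add, eval_C, eval_pow, eval_X,
    eval_map_algebraMap] at h
  have hr := root_relation hβ hz
  obtain ⟨k, rfl⟩ : ∃ k, n = k + 1 := ⟨n - 1, by omega⟩
  rw [Nat.add_sub_cancel] at h ⊢
  refine mul_left_cancel₀ (two_mul_sub_one_ne_zero hz) ?_
  rw [pow_succ, pow_succ] at hr
  linear_combination (β + z) * h - ((k + 1 : ℕ) : ℂ) * hr

/-- The square of the derivative at a root. -/
theorem derivative_root_sq (hβ : aeval β (simplestPolyRat n m) = 0) (hn : 2 ≤ n) :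
    aeval β (derivative (simplestPolyRat n m)) ^ 2 =
      n ^ 2 * (m ^ 2 + m + 1) * (β ^ 2 + β + 1) ^ (n - 2) := by
  obtain ⟨z, hz⟩ := exists_sixth_root
  have h1 := derivative_mul_root_add hβ (by omega) hz
  have h2 := derivative_mul_root_add hβ (by omega) (z := 1 - z) (by linear_combination hz)
  have hw : β ^ 2 + β + 1 = (β + z) * (β + (1 - z)) := by linear_combination hz
  have hm : (m : ℂ) ^ 2 + m + 1 = (m + z) * (m + (1 - z)) := by linear_combination hz
  refine mul_right_cancel₀ (root_sq_add_add_one_ne_zero hβ (by omega)) ?_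
  obtain ⟨k, rfl⟩ : ∃ k, n = k + 2 := ⟨n - 2, by omega⟩
  rw [Nat.add_sub_cancel, mul_assoc _ ((β ^ 2 + β + 1) ^ k), ← pow_succ, hw, hm, mul_pow]
  rw [show k + 2 - 1 = k + 1 by omega] at h1 h2
  rw [show 1 - (1 - z) = z by ring] at h2
  calc _ = (aeval β (derivative (simplestPolyRat (k + 2) m)) * (β + z)) *
        (aeval β (derivative (simplestPolyRat (k + 2) m)) * (β + (1 - z))) := by ring
    _ = _ := by rw [h1, h2]; ring

/-- The ratio g = (β + 1 - z)/(β + z) satisfies l(m + z)g^n = l(m + 1 - z), and 1 - g = (2z - 1)/(β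
+ z). So `IsIntegral.mul_one_sub_pow` applies; l clears the denominator of m. -/
theorem isIntegral_root_add_pow_dvd (hβ : aeval β (simplestPolyRat n m) = 0) (hn : 0 < n)
    {l t : ℤ} (hlt : (l : ℚ) * m = t) {z : ℂ} (hz : z ^ 2 - z + 1 = 0) :
    ∃ q : ℂ, IsIntegral ℤ q ∧ (β + z) ^ n * q = l * (m + z) * (2 * z - 1) ^ n := by
  have hu := root_add_ne_zero hβ hn hz
  have hzi : ∀ x : ℂ, x ^ 2 - x + 1 = 0 → IsIntegral ℤ ((l : ℂ) * (m + x)) := by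
    intro x hx
    have hxi : IsIntegral ℤ x := ⟨X ^ 2 - X + 1, by monicity!, by simpa using hx⟩
    have : (l : ℂ) * (m + x) = (t : ℤ) + l * x := by
      have h' : (l : ℂ) * m = t := by exact_mod_cast hlt
      linear_combination h'
    rw [this]
    exact (isIntegral_algebraMap (x := t)).add ((isIntegral_algebraMap (x := l)).mul hxi)
  refine ⟨l * (m + z) * (1 - (β + (1 - z)) / (β + z)) ^ n,
    (hzi z hz).mul_one_sub_pow (hzi (1 - z) (by linear_combination hz)) hn ?_, ?_⟩
  · rw [div_pow, ← mul_div_assoc, div_eq_iff (pow_ne_zero _ hu), mul_assoc, mul_assoc,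
      root_relation hβ hz]
  · have h1 : (2 * z - 1 : ℂ) = (β + z) * (1 - (β + (1 - z)) / (β + z)) := by
      field_simp
      ring
    rw [h1, mul_pow]
    ring

/-- The `n`-th power of `β ^ 2 + β + 1` divides `3 ^ n` times the discriminant form. -/
theorem isIntegral_sq_add_add_one_pow_dvd (hβ : aeval β (simplestPolyRat n m) = 0) (hn : 0 < n)
    {l t D : ℤ} (hlt : (l : ℚ) * m = t) (hD : (D : ℚ) = l ^ 2 * (m ^ 2 + m + 1)) :
    ∃ q : ℂ, IsIntegral ℤ q ∧ (β ^ 2 + β + 1) ^ n * q = D * 3 ^ n := by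
  obtain ⟨z, hz⟩ := exists_sixth_root
  obtain ⟨q, hq, h1⟩ := isIntegral_root_add_pow_dvd hβ hn hlt hz
  obtain ⟨q', hq', h2⟩ := isIntegral_root_add_pow_dvd hβ hn hlt (z := 1 - z)
    (by linear_combination hz)
  refine ⟨q * q', hq.mul hq', ?_⟩
  have hw : β ^ 2 + β + 1 = (β + z) * (β + (1 - z)) := by linear_combination hz
  have hD' : (D : ℂ) = l ^ 2 * ((m + z) * (m + (1 - z))) := by
    have : (D : ℂ) = l ^ 2 * (m ^ 2 + m + 1) := by exact_mod_cast hD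
    rw [this]
    linear_combination l ^ 2 * hz
  have h3 : (3 : ℂ) = (2 * z - 1) * (2 * (1 - z) - 1) := by linear_combination 4 * hz
  calc _ = ((β + z) ^ n * q) * ((β + (1 - z)) ^ n * q') := by rw [hw, mul_pow]; ring
    _ = _ := by rw [h1, h2, hD', h3, mul_pow]; ring

/-- The bound on the different that controls the denominators of integral elements. -/
theorem exists_pow_div_derivative_eq (hβ : aeval β (simplestPolyRat n m) = 0) (hn : 2 ≤ n)
    {l D d e c : ℤ} (hl : l ≠ 0) (hc : c ≠ 0) (hD0 : D ≠ 0)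
    (hD : (D : ℚ) = l ^ 2 * (m ^ 2 + m + 1))
    (hd : l ^ 2 * d ^ 2 = n ^ 2 * c ^ (n - 2) * e)
    (hQ : ∃ q : ℂ, IsIntegral ℤ q ∧ (β ^ 2 + β + 1) ^ n * q = D * c ^ n) :
    ∃ y : ℂ, IsIntegral ℤ y ∧
      ((D : ℂ) * d / aeval β (derivative (simplestPolyRat n m))) ^ (2 * n) = D * y := by
  obtain ⟨q, hq, hw⟩ := hQ
  set δ := aeval β (derivative (simplestPolyRat n m)) with hδ
  have hsq := derivative_root_sq hβ hn
  rw [← hδ] at hsq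
  have hw0 := root_sq_add_add_one_ne_zero hβ (by omega)
  set w := β ^ 2 + β + 1 with hwdef
  have hD' : (D : ℂ) = l ^ 2 * (m ^ 2 + m + 1) := by exact_mod_cast hD
  have hd' : (l : ℂ) ^ 2 * d ^ 2 = n ^ 2 * c ^ (n - 2) * e := by exact_mod_cast hd
  have hlC : (l : ℂ) ≠ 0 := by exact_mod_cast hl
  have hcC : (c : ℂ) ≠ 0 := by exact_mod_cast hc
  have hDC : (D : ℂ) ≠ 0 := by exact_mod_cast hD0
  have hnC : (n : ℂ) ≠ 0 := by exact_mod_cast (by omega : n ≠ 0)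
  have hδ2 : (l : ℂ) ^ 2 * δ ^ 2 = n ^ 2 * D * w ^ (n - 2) := by
    rw [hsq, hD']
    ring
  have hδ0 : δ ≠ 0 := by
    intro h
    rw [h] at hδ2
    have : (n : ℂ) ^ 2 * D * w ^ (n - 2) ≠ 0 :=
      mul_ne_zero (mul_ne_zero (pow_ne_zero _ hnC) hDC) (pow_ne_zero _ hw0)
    exact this (by rw [← hδ2]; ring)
  -- From l²δ² = n² D w^(n-2) and l²d² = n² c^(n-2) e, the quotient (d/δ)^(2n) equals (c^(n-2) e)^n
  -- / (D w^(n-2))^n. Eliminating w by w^n q = D c^n turns this into e^n q^(n-2) / D^(2n-2).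
  refine ⟨D * e ^ n * q ^ (n - 2), ?_, ?_⟩
  · exact ((isIntegral_algebraMap (x := D)).mul ((isIntegral_algebraMap (x := e)).pow n)).mul
      (hq.pow _)
  · rw [div_pow, div_eq_iff (pow_ne_zero _ hδ0)]
    refine mul_left_cancel₀ (pow_ne_zero n (pow_ne_zero 2 hlC)) ?_
    have hwq : (w ^ (n - 2)) ^ n * q ^ (n - 2) = (D * c ^ n) ^ (n - 2) := by
      rw [← hw, mul_pow, ← pow_mul, ← pow_mul, mul_comm n]
    have hDD : (D : ℂ) ^ (2 * n) = D * D * D ^ (n - 2) * D ^ n := by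
      rw [← pow_two, ← pow_add, ← pow_add]
      congr 1
      omega
    calc _ = D ^ (2 * n) * ((l : ℂ) ^ 2 * d ^ 2) ^ n := by
          rw [mul_pow (D : ℂ), mul_pow _ ((d : ℂ) ^ 2), ← pow_mul (d : ℂ)]; ring
      _ = (D * c ^ n) ^ (n - 2) * (n ^ 2 * D) ^ n * (D * D * e ^ n) := by
          rw [hd', hDD, mul_pow, mul_pow, mul_pow, mul_pow, ← pow_mul (c : ℂ) (n - 2),
            mul_comm (n - 2), pow_mul (c : ℂ)]
          ring
      _ = ((l : ℂ) ^ 2 * δ ^ 2) ^ n * (D * (D * e ^ n * q ^ (n - 2))) := by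
          rw [← hwq, hδ2, mul_pow _ (w ^ (n - 2))]
          ring
      _ = _ := by
          rw [mul_pow _ (δ ^ 2), ← pow_mul δ]
          ring

end Root

/-! ### The integer parameter and the table of denominators -/

theorem isIntegral_of_aeval_simplestPoly {n : ℕ} {t : ℤ} {β : ℂ}
    (hβ : aeval β (simplestPoly n t) = 0) : IsIntegral ℤ β := by
  obtain ⟨F₀, F₁, hF⟩ := exists_int_simplestPoly n
  refine ⟨F₀ + C t * F₁, ?_, ?_⟩
  · refine monic_of_injective (Int.castRingHom ℚ).injective_int ?_
    rw [hF]
    exact simplestPoly_monic n t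
  · rw [← hF t] at hβ
    exact (aeval_map_algebraMap ℚ β _).symm.trans hβ

/-- For the simplest cubics β and 1 + β are units and (β² + β + 1)³ = D (β(1 + β))². This removes
the factor 3^n of the general bound, which would not allow d = 1. -/
theorem isIntegral_sq_add_add_one_pow_dvd_three {t : ℤ} {β : ℂ}
    (hβ : aeval β (simplestPoly 3 t) = 0) :
    ∃ q : ℂ, IsIntegral ℤ q ∧
      (β ^ 2 + β + 1) ^ 3 * q = (paramForm 3 t : ℤ) * ((1 : ℤ) : ℂ) ^ 3 := by
  have hβi := isIntegral_of_aeval_simplestPoly hβ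
  -- The two quadratic factors are the inverses of β and of -(1 + β), read off from the cubic
  -- equation.
  refine ⟨((β ^ 2 - t * β - t - 3) * (β ^ 2 - (t + 1) * β - 2)) ^ 2, ?_, ?_⟩
  · have : ((β ^ 2 - t * β - t - 3) * (β ^ 2 - (t + 1) * β - 2)) ^ 2 =
        aeval β (((X ^ 2 - C t * X - C t - 3) * (X ^ 2 - (C t + 1) * X - 2)) ^ 2 : ℤ[X]) := by
      simp [map_ofNat]
    rw [this]
    exact hβi.of_mem_adjoin_singleton (aeval_mem_adjoin_singleton ℤ β)
  · have h : β ^ 3 - t * β ^ 2 - (t + 3) * β - 1 = 0 := by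
      simp [simplestPoly, simplestPolyRat, Finset.sum_range_succ, simplestG, map_ofNat] at hβ
      linear_combination hβ
    have h1 : (β ^ 2 + β + 1) ^ 3 = (t ^ 2 + 3 * t + 9) * (β * (1 + β)) ^ 2 := by
      linear_combination (β ^ 3 + (t + 3) * β ^ 2 + t * β - 1) * h
    have h2 : β * (β ^ 2 - t * β - t - 3) = 1 := by linear_combination h
    have h3 : (1 + β) * (β ^ 2 - (t + 1) * β - 2) = -1 := by linear_combination h
    calc _ = (t ^ 2 + 3 * t + 9) * ((β * (β ^ 2 - t * β - t - 3)) *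
          ((1 + β) * (β ^ 2 - (t + 1) * β - 2))) ^ 2 := by rw [h1]; ring
      _ = _ := by rw [h2, h3]; simp [paramForm]

theorem paramForm_eq (n : ℕ) (t : ℤ) :
    (paramForm n t : ℚ) = ((if n % 3 = 0 then 3 else 1 : ℤ) : ℚ) ^ 2 *
      ((if n % 3 = 0 then (t : ℚ) / 3 else (t : ℚ)) ^ 2 +
        (if n % 3 = 0 then (t : ℚ) / 3 else (t : ℚ)) + 1) := by
  unfold paramForm
  split_ifs <;> push_cast <;> ring

/-- The bound on the different in terms of the integer parameter, for denominators dividing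
`d`. -/
theorem exists_pow_div_derivative_simplestPoly {n : ℕ} (hn : 2 ≤ n) {d e c : ℤ}
    (hc : c = 3 ∨ c = 1 ∧ n = 3)
    (hd : (if n % 3 = 0 then 3 else 1) ^ 2 * d ^ 2 = n ^ 2 * c ^ (n - 2) * e) {t : ℤ}
    (hD : paramForm n t ≠ 0) {β : ℂ} (hβ : aeval β (simplestPoly n t) = 0) :
    ∃ y : ℂ, IsIntegral ℤ y ∧ (((paramForm n t : ℤ) : ℂ) * d /
      aeval β (derivative (simplestPoly n t))) ^ (2 * n) = (paramForm n t : ℤ) * y := by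
  refine exists_pow_div_derivative_eq (c := c) hβ hn (l := if n % 3 = 0 then 3 else 1)
    (by split_ifs <;> norm_num) (by rcases hc with rfl | ⟨rfl, _⟩ <;> norm_num) hD
    (paramForm_eq n t) hd ?_
  rcases hc with rfl | ⟨rfl, rfl⟩
  · have := isIntegral_sq_add_add_one_pow_dvd hβ (by omega)
      (l := if n % 3 = 0 then 3 else 1) (t := t) ?_ (paramForm_eq n t)
    · simpa using this
    · split_ifs <;> push_cast <;> ring
  · exact isIntegral_sq_add_add_one_pow_dvd_three hβ

/-- Here d is the base of the tabulated power, and e is the surplus of l²d² over n² c^(n-2), where l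
is 3 or 1 according as 3 divides n or not. Any integer e would do. -/
theorem exists_denominator {n : ℕ} (hn : 2 ≤ n) (hn' : n ≤ 12) :
    ∃ d e c : ℤ, (d : ℤ) ^ n = periodLength n ∧ d ≠ 0 ∧ (c = 3 ∨ c = 1 ∧ n = 3) ∧
      (if n % 3 = 0 then 3 else 1) ^ 2 * d ^ 2 = n ^ 2 * c ^ (n - 2) * e := by
  interval_cases n
  · exact ⟨2, 1, 3, by norm_num [periodLength]⟩
  · exact ⟨1, 1, 1, by norm_num [periodLength]⟩
  · exact ⟨3 * 4, 1, 3, by norm_num [periodLength]⟩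
  · exact ⟨3 ^ 3 * 5, 3 ^ 3, 3, by norm_num [periodLength]⟩
  · exact ⟨3 ^ 2 * 6, 3 ^ 2, 3, by norm_num [periodLength]⟩
  · exact ⟨3 ^ 4 * 7, 3 ^ 3, 3, by norm_num [periodLength]⟩
  · exact ⟨3 ^ 5 * 8, 3 ^ 4, 3, by norm_num [periodLength]⟩
  · exact ⟨3 ^ 4 * 9, 3 ^ 3, 3, by norm_num [periodLength]⟩
  · exact ⟨3 ^ 6 * 10, 3 ^ 4, 3, by norm_num [periodLength]⟩
  · exact ⟨3 ^ 9 * 11, 3 ^ 9, 3, by norm_num [periodLength]⟩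
  · exact ⟨3 ^ 8 * 12, 3 ^ 8, 3, by norm_num [periodLength]⟩

/-! ### Polynomial representatives and integral bases of ℚ(β) -/

theorem eq_zero_of_degree_lt_of_aeval {n : ℕ} {f : ℚ[X]} (hfd : f.natDegree = n)
    (hirr : Irreducible f) {β : ℂ} (hβ : aeval β f = 0) {P : ℚ[X]} (hP : P.degree < n)
    (h : aeval β P = 0) : P = 0 := by
  have h1 : f ∣ P := by
    have := minpoly.dvd ℚ β h
    rw [← minpoly.eq_of_irreducible hirr hβ] at this
    exact (dvd_mul_right _ _).trans this
  refine eq_zero_of_dvd_of_degree_lt h1 ?_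
  rwa [degree_eq_natDegree hirr.ne_zero, hfd]

section Adjoin

open IntermediateField

theorem coe_aeval_gen (β : ℂ) (P : ℚ[X]) :
    algebraMap (adjoin ℚ {β}) ℂ (aeval (AdjoinSimple.gen ℚ β) P) = aeval β P := by
  rw [← aeval_algebraMap_apply, AdjoinSimple.algebraMap_gen]

theorem isIntegral_aeval_gen {β : ℂ} {P : ℚ[X]} :
    IsIntegral ℤ (aeval (AdjoinSimple.gen ℚ β) P) ↔ IsIntegral ℤ (aeval β P) := by
  rw [← coe_aeval_gen, isIntegral_algebraMap_iff (algebraMap (adjoin ℚ {β}) ℂ).injective]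

theorem exists_aeval_gen_eq {n : ℕ} {f : ℚ[X]} (hfm : f.Monic) (hfd : f.natDegree = n) {β : ℂ}
    (hβ : aeval β f = 0) (x : adjoin ℚ {β}) :
    ∃ P : ℚ[X], P.degree < n ∧ aeval (AdjoinSimple.gen ℚ β) P = x := by
  have hβi : IsIntegral ℚ β := ⟨f, hfm, hβ⟩
  obtain ⟨P, hP⟩ := (adjoin.powerBasis hβi).exists_eq_aeval' x
  rw [adjoin.powerBasis_gen] at hP
  refine ⟨P %ₘ f, ?_, ?_⟩
  · have := degree_modByMonic_lt P hfm
    rwa [degree_eq_natDegree hfm.ne_zero, hfd] at this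
  · have hgen : aeval (AdjoinSimple.gen ℚ β) f = 0 := by
      apply (algebraMap (adjoin ℚ {β}) ℂ).injective
      rw [coe_aeval_gen, hβ, map_zero]
    rw [hP]
    exact aeval_modByMonic_eq_self_of_root hgen

/-- The integer `d` is a common denominator of the integral elements of `ℚ(β)` with respect to
the powers of `β`. -/
theorem exists_int_eq_C_mul {n : ℕ} {F : ℤ[X]} (hFm : F.Monic) (hFd : F.natDegree = n)
    (hirr : Irreducible (F.map (Int.castRingHom ℚ))) {β : ℂ}
    (hβ : aeval β (F.map (Int.castRingHom ℚ)) = 0) {D d : ℤ} (hD : Squarefree D) {N : ℕ}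
    (hN : N ≠ 0) (hy : ∃ y : ℂ, IsIntegral ℤ y ∧ ((D : ℂ) * d /
      aeval β (derivative (F.map (Int.castRingHom ℚ)))) ^ N = D * y)
    {P : ℚ[X]} (hP : P.degree < n) (hPi : IsIntegral ℤ (aeval β P)) :
    ∃ a : ℤ[X], C (d : ℚ) * P = a.map (Int.castRingHom ℚ) := by
  set f := F.map (Int.castRingHom ℚ) with hf
  have hfm : f.Monic := hFm.map _
  have hfd : f.natDegree = n := by rw [hf, hFm.natDegree_map, hFd]
  have hβi : IsIntegral ℚ β := ⟨f, hfm, hβ⟩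
  have : FiniteDimensional ℚ (adjoin ℚ {β}) := adjoin.finiteDimensional hβi
  obtain ⟨y, hyi, hy⟩ := hy
  set θ := AdjoinSimple.gen ℚ β with hθ
  have hmapF : ∀ (x : ℂ) (Q : ℤ[X]), aeval x (Q.map (Int.castRingHom ℚ)) = aeval x Q :=
    fun x Q => aeval_map_algebraMap ℚ x Q
  have hmapθ : ∀ Q : ℤ[X], aeval θ (Q.map (Int.castRingHom ℚ)) = aeval θ Q :=
    fun Q => aeval_map_algebraMap ℚ θ Q
  have hinj := (algebraMap (adjoin ℚ {β}) ℂ).injective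
  have hθi : IsIntegral ℤ θ := by
    refine ⟨F, hFm, ?_⟩
    change aeval θ F = 0
    rw [← hmapθ]
    apply hinj
    rw [coe_aeval_gen, ← hf, hβ, map_zero]
  have htop : Algebra.adjoin ℚ {θ} = ⊤ := by
    have := (adjoin.powerBasis hβi).adjoin_gen_eq_top
    rwa [adjoin.powerBasis_gen] at this
  have hmin : minpoly ℚ θ = f := by
    rw [← minpoly.algebraMap_eq hinj θ, AdjoinSimple.algebraMap_gen]
    exact (minpoly.eq_of_irreducible_of_monic hirr hβ hfm).symm
  have hD0 : ((D : ℤ) : adjoin ℚ {β}) ≠ 0 := by exact_mod_cast hD.ne_zero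
  have hDC : (D : ℂ) ≠ 0 := by exact_mod_cast hD.ne_zero
  have hval : algebraMap (adjoin ℚ {β}) ℂ
      (((D : adjoin ℚ {β}) * d / aeval θ (derivative (minpoly ℚ θ))) ^ N / D) = y := by
    rw [hmin, map_div₀, map_pow, map_div₀, coe_aeval_gen, map_mul, map_intCast, map_intCast, hy,
      mul_div_cancel_left₀ _ hDC]
  have hx := smul_mem_adjoin_of_pow_eq htop hθi hD (d := d)
    (y := ((D : adjoin ℚ {β}) * d / aeval θ (derivative (minpoly ℚ θ))) ^ N / D) hN
    (by rw [← isIntegral_algebraMap_iff hinj, hval]; exact hyi)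
    (by rw [mul_div_cancel₀ _ hD0]) (isIntegral_aeval_gen.2 hPi)
  rw [Algebra.adjoin_singleton_eq_range_aeval] at hx
  obtain ⟨A, hA⟩ := hx
  -- Division by the monic F keeps the coefficients integral and brings the degree below n, where
  -- equal values at β force equal polynomials.
  refine ⟨A %ₘ F, ?_⟩
  rw [← sub_eq_zero]
  refine eq_zero_of_degree_lt_of_aeval hfd hirr hβ ?_ ?_
  · refine (degree_sub_le _ _).trans_lt (max_lt ?_ ?_)
    · rw [← smul_eq_C_mul]
      exact (degree_smul_le _ _).trans_lt hP
    · refine degree_map_le.trans_lt ?_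
      have := degree_modByMonic_lt A hFm
      rwa [degree_eq_natDegree hFm.ne_zero, hFd] at this
  · have hFβ : aeval β F = 0 := by rw [← hmapF, ← hf, hβ]
    have h1 := congrArg (algebraMap (adjoin ℚ {β}) ℂ) hA
    have h2 : algebraMap (adjoin ℚ {β}) ℂ (aeval θ A) = aeval β A := by
      rw [← hmapθ, coe_aeval_gen, hmapF]
    rw [map_sub, hmapF, aeval_modByMonic_eq_self_of_root hFβ, ← h2]
    refine sub_eq_zero.2 ?_
    refine Eq.trans ?_ h1.symm
    rw [map_mul (aeval β), map_mul (algebraMap (adjoin ℚ {β}) ℂ), coe_aeval_gen, map_intCast]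
    simp

theorem linearIndependent_of_degree_eq {n : ℕ} (h : Fin n → ℚ[X])
    (hdeg : ∀ i, (h i).degree = ((i : ℕ) : WithBot ℕ)) : LinearIndependent ℚ h := by
  -- The powers X^i with i ≥ n are mere padding to an infinite sequence with one polynomial in each
  -- degree.
  let S : Polynomial.Sequence ℚ :=
    { elems' := fun i => if hi : i < n then h ⟨i, hi⟩ else X ^ i
      degree_eq' := fun i => by
        split_ifs with hi
        · exact hdeg ⟨i, hi⟩
        · exact degree_X_pow i }
  have hS : h = S ∘ Fin.val := by
    funext i
    simp [S]
  rw [hS]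
  exact S.linearIndependent.comp _ Fin.val_injective

/-- Polynomials of degrees `0, …, n - 1` that span the integral elements over `ℤ` give an integral
basis. -/
theorem isIntegralBasis_of_span {n : ℕ} {f : ℚ[X]} (hfm : f.Monic) (hfd : f.natDegree = n)
    (hirr : Irreducible f) {β : ℂ} (hβ : aeval β f = 0) {h : Fin n → ℚ[X]}
    (hdeg : ∀ i, (h i).degree = ((i : ℕ) : WithBot ℕ))
    (hint : ∀ i, IsIntegral ℤ (aeval β (h i)))
    (hspan : ∀ P : ℚ[X], P.degree < n → IsIntegral ℤ (aeval β P) →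
      P ∈ Submodule.span ℤ (Set.range h)) :
    IsIntegralBasis (K := adjoin ℚ {β}) (fun i => aeval (AdjoinSimple.gen ℚ β) (h i)) := by
  let v : Fin n → NumberField.RingOfIntegers (adjoin ℚ {β}) :=
    fun i => ⟨aeval (AdjoinSimple.gen ℚ β) (h i), isIntegral_aeval_gen.2 (hint i)⟩
  have hli : LinearIndependent ℤ v := by
    have h1 : LinearIndependent ℤ h :=
      (linearIndependent_of_degree_eq h hdeg).restrict_scalars' ℤ
    rw [Fintype.linearIndependent_iff] at h1 ⊢
    intro c hc
    refine h1 c ?_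
    refine eq_zero_of_degree_lt_of_aeval hfd hirr hβ ?_ ?_
    · rw [← mem_degreeLT]
      refine Submodule.sum_mem _ fun i _ => ?_
      rw [← Int.cast_smul_eq_zsmul ℚ]
      refine Submodule.smul_mem _ _ ?_
      rw [mem_degreeLT, hdeg]
      exact_mod_cast i.2
    · have h2 := congrArg (fun x : NumberField.RingOfIntegers (adjoin ℚ {β}) =>
        algebraMap (adjoin ℚ {β}) ℂ (algebraMap _ (adjoin ℚ {β}) x)) hc
      simp only [map_sum, map_zero, map_zsmul] at h2 ⊢
      rw [← h2]
      refine Finset.sum_congr rfl fun i _ => ?_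
      rw [← coe_aeval_gen]
      rfl
  have hsp : ⊤ ≤ Submodule.span ℤ (Set.range v) := by
    intro x _
    obtain ⟨P, hPd, hPx⟩ := exists_aeval_gen_eq hfm hfd hβ (x : adjoin ℚ {β})
    have hPi : IsIntegral ℤ (aeval β P) := by
      rw [← isIntegral_aeval_gen, hPx]
      exact x.isIntegral_coe
    have hmem := hspan P hPd hPi
    rw [Submodule.mem_span_range_iff_exists_fun] at hmem ⊢
    obtain ⟨c, hc⟩ := hmem
    refine ⟨c, NumberField.RingOfIntegers.ext ?_⟩
    rw [← hPx, ← hc]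
    simp only [map_sum, map_zsmul]
    rfl
  refine ⟨Module.Basis.mk hli hsp, fun i => ?_⟩
  rw [Module.Basis.mk_apply]
  rfl

end Adjoin

/-! ### Periodicity of the integral basis -/

theorem mainTheorem2 (n : ℕ) (hn : 2 ≤ n) (hn' : n ≤ 12) :
    RepeatsPeriodicallyMod n (simplestPoly n) {t : ℤ | Squarefree (paramForm n t)}
      (periodLength n) := by
  intro r
  -- The basis polynomials are read off from one admissible t₀ in the class; without such t₀ the
  -- requirement is vacuous and any polynomials of the right degrees serve.
  by_cases hex : ∃ t₀ : ℤ, Squarefree (paramForm n t₀) ∧ t₀ ≡ r [ZMOD periodLength n] ∧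
      Irreducible (simplestPoly n t₀)
  swap
  · exact ⟨fun i => X ^ (i : ℕ), fun i => degree_X_pow _,
      fun t ht htr hirr => absurd ⟨t, ht, htr, hirr⟩ hex⟩
  obtain ⟨t₀, ht₀, ht₀r, hirr₀⟩ := hex
  obtain ⟨d, e, c, hdn, hd0, hc, hde⟩ := exists_denominator hn hn'
  obtain ⟨F₀, F₁, hF⟩ := exists_int_simplestPoly n
  have hinj := (Int.castRingHom ℚ).injective_int
  have hmonic : ∀ t : ℤ, (F₀ + C t * F₁).Monic := fun t =>
    monic_of_injective hinj (by rw [hF]; exact simplestPoly_monic n t)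
  have hdegree : ∀ t : ℤ, (F₀ + C t * F₁).natDegree = n := fun t => by
    rw [← (hmonic t).natDegree_map (Int.castRingHom ℚ), hF, simplestPoly_natDegree]
  have hden : ∀ t : ℤ, Squarefree (paramForm n t) → Irreducible (simplestPoly n t) →
      ∀ β : ℂ, aeval β (simplestPoly n t) = 0 → ∀ P : ℚ[X], P.degree < n →
      IsIntegral ℤ (aeval β P) → ∃ a : ℤ[X], C (d : ℚ) * P = a.map (Int.castRingHom ℚ) := by
    intro t ht hirr β hβ P hP hPi
    have hy := exists_pow_div_derivative_simplestPoly hn hc hde ht.ne_zero hβ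
    rw [← hF t] at hβ hirr hy
    exact exists_int_eq_C_mul (hmonic t) (hdegree t) hirr hβ ht (by omega) hy hP hPi
  have htransfer : ∀ t t' : ℤ, t ≡ t' [ZMOD periodLength n] → Squarefree (paramForm n t) →
      Irreducible (simplestPoly n t) → ∀ β β' : ℂ, aeval β (simplestPoly n t) = 0 →
      aeval β' (simplestPoly n t') = 0 → ∀ P : ℚ[X], P.degree < n →
      IsIntegral ℤ (aeval β P) → IsIntegral ℤ (aeval β' P) := by
    intro t t' htt' ht hirr β β' hβ hβ' P hP hPi
    obtain ⟨a, ha⟩ := hden t ht hirr β hβ P hP hPi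
    rw [← hF] at hβ hβ' hirr
    refine isIntegral_aeval_of_congr (hmonic t) (hmonic t') (hdegree t) hirr ?_
      ((aeval_map_algebraMap ℚ β _).symm.trans hβ) ((aeval_map_algebraMap ℚ β' _).symm.trans hβ')
      hd0 ha hPi
    obtain ⟨k, hk⟩ := htt'.symm.dvd
    refine ⟨C k * F₁, ?_⟩
    rw [← mul_assoc, ← C_mul, hdn, ← hk, C_sub]
    ring
  have hdeg₀ : (simplestPoly n t₀).degree ≠ 0 := by
    rw [degree_eq_natDegree (simplestPoly_monic n t₀).ne_zero, simplestPoly_natDegree]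
    exact_mod_cast (by omega : n ≠ 0)
  obtain ⟨β₀, hβ₀⟩ := IsAlgClosed.exists_aeval_eq_zero ℂ (simplestPoly n t₀) hdeg₀
  have hβ₀i := isIntegral_of_aeval_simplestPoly hβ₀
  -- Λ consists of all polynomials, of any degree, with integral value at β₀; only its part in
  -- degree below n has denominators bounded by d.
  let Λ : AddSubgroup ℚ[X] :=
    (integralClosure ℤ ℂ).toSubring.toAddSubgroup.comap (aeval β₀ : ℚ[X] →ₐ[ℚ] ℂ).toAddMonoidHom
  have hΛ : ∀ P, P ∈ Λ ↔ IsIntegral ℤ (aeval β₀ P) := fun P => Iff.rfl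
  obtain ⟨h, hdeg, hmem, hspan⟩ := exists_triangular_span Λ n d hd0
    (fun i _ => by rw [hΛ, map_pow, aeval_X]; exact hβ₀i.pow i)
    (fun P hP hPd j => by
      obtain ⟨a, ha⟩ := hden t₀ ht₀ hirr₀ β₀ hβ₀ P hPd hP
      refine ⟨a.coeff j, ?_⟩
      rw [← coeff_C_mul, ha, coeff_map, eq_intCast])
  refine ⟨h, hdeg, fun t ht htr hirr β hβ => ?_⟩
  have htt : t ≡ t₀ [ZMOD periodLength n] := htr.trans ht₀r.symm
  refine isIntegralBasis_of_span (simplestPoly_monic n t) (simplestPoly_natDegree n t) hirr hβ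
    hdeg (fun i => ?_) (fun P hPd hPi => ?_)
  -- Transfer from t₀ to t makes the chosen elements integral; transfer from t to t₀, below, shows
  -- that they span.
  · refine htransfer t₀ t htt.symm ht₀ hirr₀ β₀ β hβ₀ hβ (h i) ?_ (hmem i)
    rw [hdeg]
    exact_mod_cast i.2
  · exact hspan P (htransfer t t₀ htt ht hirr β β₀ hβ hβ₀ P hPd hPi) hPd
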